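/- Let $n\ge 3$, let $A=\mathbb{C}[x_1,\dots,x_n]$ and let $B=\mathbb{C}(x_1,\dots,x_n)$. For $1\le i\le n-2$ let $s_i,t_i\in A$ be coprime (i.e. without non-unit common factor) with $t_i\neq 0$, and assume that $s_1/t_1,\dots,s_{n-2}/t_{n-2}$ are algebraically independent over $\mathbb{C}$. Give $B$ the Poisson bracket $$\{f,g\}=(t_1t_2\cdots t_{n-2})^2\,\mathrm{Jac}\left(f,g,\frac{s_1}{t_1},\dots,\frac{s_{n-2}}{t_{n-2}}\right),$$ where $\mathrm{Jac}(b_1,\dots,b_n)=\det\left(\partial b_i/\partial x_j\right)$. Let $\gamma=((\gamma_1,\delta_1),\dots,(\gamma_{n-2},\delta_{n-2}))$ be a sequence in $\{0,1\}\times\{0,1\}$ that is dense, i.e. $(\gamma_i,\delta_i)\neq(0,0)$ for all $i$. Let $S_\gamma$ be the set consisting of those $s_i$ with $\gamma_i=1$ and those $t_i$ with $\delta_i=1$, let $M_\gamma$ be the multiplicatively closed subset of $A$ generated by $S_\gamma$, and let $A_\gamma=M_\gamma^{-1}A\subseteq B$, with the restriction of the above bracket (under which $A_\gamma$ is closed).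 Put $v_i=s_i/t_i$ if $\delta_i=1$ and $v_i=t_i/s_i$ otherwise; then $v_i\in A_\gamma$ for all $i$. Let $C_\gamma=\mathbb{C}[v_1,\dots,v_{n-2}]$ be the $\mathbb{C}$-subalgebra of $A_\gamma$ generated by $v_1,\dots,v_{n-2}$. An ideal $I$ of $A_\gamma$ is a Poisson ideal if $\{i,r\}\in I$ for all $i\in I$ and $r\in A_\gamma$. A Poisson ideal $P\neq A_\gamma$ is Poisson prime if, for all Poisson ideals $I,J$ of $A_\gamma$, $IJ\subseteq P$ implies $I\subseteq P$ or $J\subseteq P$. A Poisson prime ideal $P$ is called proper if it is not residually null, i.e. if the bracket induced on $A_\gamma/P$ is not identically zero. Write $\mathrm{ht}$ for the height of an ideal. 1. Let $I$ be an ideal of $C_\gamma$ and let $Q$ be a prime ideal of $A_\gamma$ that is minimal over $IA_\gamma$. Then $Q$ is a Poisson prime ideal of $A_\gamma$. 2. If $Q$ is a nonzero proper Poisson prime ideal of $A_\gamma$, then $\mathrm{ht}(Q)=\mathrm{ht}(Q\cap C_\gamma)$. 3. If $Q$ is a nonzero proper Poisson prime ideal of $A_\gamma$, then $Q$ is a minimal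 prime ideal over $(Q\cap C_\gamma)A_\gamma$. -/

import Mathlib

noncomputable section

namespace PoissonSpectra

/-! ### Poisson ideals

Throughout, `br : R → R → R` is the bracket `{-,-}` of a commutative ring `R`. -/

section Ideals

variable {R : Type*} [CommRing R]

/-- `I` is a Poisson ideal: `{i, r} ∈ I` for all `i ∈ I` and `r ∈ R`. -/
def IsPoissonIdeal (br : R → R → R) (I : Ideal R) : Prop :=
  ∀ i ∈ I, ∀ r : R, br i r ∈ I

/-- `P` is a Poisson prime ideal: a Poisson ideal, different from `R`, such that for all Poisson
ideals `I` and `J`, `I J ⊆ P` implies `I ⊆ P` or `J ⊆ P`. -/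
def IsPoissonPrime (br : R → R → R) (P : Ideal R) : Prop :=
  IsPoissonIdeal br P ∧ P ≠ ⊤ ∧
    ∀ I J : Ideal R, IsPoissonIdeal br I → IsPoissonIdeal br J → I * J ≤ P → I ≤ P ∨ J ≤ P

/-- `I` is residually null: the bracket induced on `R / I` is zero. -/
def IsResiduallyNull (br : R → R → R) (I : Ideal R) : Prop :=
  ∀ a b : R, Ideal.Quotient.mk I (br a b) = 0

/-- `Q` is a proper Poisson prime ideal: it is Poisson prime and not residually null. -/
def IsProperPoissonPrime (br : R → R → R) (Q : Ideal R) : Prop :=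
  IsPoissonPrime br Q ∧ ¬ IsResiduallyNull br Q

end Ideals

/-! ### Extending a derivation to the field of fractions -/

section FractionField

variable {k A K : Type*} [CommRing k] [CommRing A] [Algebra k A]
  [Field K] [Algebra A K] [IsFractionRing A K]

/-- The quotient rule `(d(p) q - p d(q)) / q²`, the candidate for `d (p / q)`. -/
def quotRule (K : Type*) [Field K] [Algebra A K] (d : Derivation k A A) (p q : A) : K :=
  algebraMap A K (d p * q - p * d q) / algebraMap A K q ^ 2

theorem quotRule_congr (d : Derivation k A A) {p q p' q' : A} (hq : q ≠ 0) (hq' : q' ≠ 0)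
    (h : algebraMap A K p / algebraMap A K q = algebraMap A K p' / algebraMap A K q') :
    quotRule K d p q = quotRule K d p' q' := by
  have hq0 : algebraMap A K q ≠ 0 := by simpa using hq
  have hq0' : algebraMap A K q' ≠ 0 := by simpa using hq'
  rw [div_eq_div_iff hq0 hq0', ← map_mul, ← map_mul] at h
  have h1 : p * q' = p' * q := IsFractionRing.injective A K h
  have h2 := congrArg d h1
  simp only [Derivation.leibniz, smul_eq_mul] at h2
  unfold quotRule
  rw [div_eq_div_iff (pow_ne_zero 2 hq0) (pow_ne_zero 2 hq0')]
  rw [← map_pow, ← map_pow, ← map_mul, ← map_mul]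
  congr 1
  linear_combination (q * q') * h2 - (d q * q' + q * d q') * h1

variable [IsDomain A]

/-- The extension of `d`, computed on a numerator and a denominator. -/
def fracDerivFun (K : Type*) [Field K] [Algebra A K] [IsFractionRing A K]
    (d : Derivation k A A) (b : K) : K :=
  quotRule K d (IsLocalization.sec (nonZeroDivisors A) b).1
    (IsLocalization.sec (nonZeroDivisors A) b).2

theorem fracDerivFun_div (d : Derivation k A A) (p q : A) (hq : q ≠ 0) :
    fracDerivFun K d (algebraMap A K p / algebraMap A K q) = quotRule K d p q := by
  have hd : ((IsLocalization.sec (nonZeroDivisors A)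
      (algebraMap A K p / algebraMap A K q)).2 : A) ≠ 0 :=
    nonZeroDivisors.coe_ne_zero _
  have hd' : algebraMap A K ((IsLocalization.sec (nonZeroDivisors A)
      (algebraMap A K p / algebraMap A K q)).2 : A) ≠ 0 := by simp
  refine quotRule_congr d hd hq ?_
  have := IsLocalization.sec_spec (nonZeroDivisors A) (algebraMap A K p / algebraMap A K q)
  rw [div_eq_iff hd', this]

theorem exists_frac_eq (A : Type*) {K : Type*} [CommRing A] [IsDomain A] [Field K] [Algebra A K]
    [IsFractionRing A K] (b : K) :
    ∃ p q : A, q ≠ 0 ∧ b = algebraMap A K p / algebraMap A K q := by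
  obtain ⟨p, q, hq, h⟩ := IsFractionRing.div_surjective A b
  exact ⟨p, q, nonZeroDivisors.ne_zero hq, h.symm⟩

/-- The extension of the derivation `d` of `A` to the field of fractions `K` of `A`. -/
def fracDeriv (K : Type*) [Field K] [Algebra A K] [IsFractionRing A K] [Algebra k K]
    [IsScalarTower k A K] (d : Derivation k A A) : Derivation k K K :=
  Derivation.mk'
    { toFun := fracDerivFun K d
      map_add' := by
        intro a b
        obtain ⟨p, q, hq, rfl⟩ := exists_frac_eq A a
        obtain ⟨p', q', hq', rfl⟩ := exists_frac_eq A b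
        have h0 : algebraMap A K q ≠ 0 := by simpa using hq
        have h0' : algebraMap A K q' ≠ 0 := by simpa using hq'
        have e : algebraMap A K p / algebraMap A K q + algebraMap A K p' / algebraMap A K q' =
            algebraMap A K (p * q' + p' * q) / algebraMap A K (q * q') := by
          simp only [map_add, map_mul]
          field_simp
        rw [e, fracDerivFun_div d _ _ hq, fracDerivFun_div d _ _ hq',
          fracDerivFun_div d _ _ (mul_ne_zero hq hq')]
        simp only [quotRule, map_add, map_mul, map_sub, Derivation.leibniz, smul_eq_mul]
        field_simp
        ring
      map_smul' := by
        intro c a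
        obtain ⟨p, q, hq, rfl⟩ := exists_frac_eq A a
        have e : c • (algebraMap A K p / algebraMap A K q) =
            algebraMap A K (c • p) / algebraMap A K q := by
          rw [Algebra.smul_def, IsScalarTower.algebraMap_apply k A K, Algebra.smul_def, map_mul,
            mul_div_assoc]
        rw [e, fracDerivFun_div d _ _ hq, fracDerivFun_div d _ _ hq, RingHom.id_apply,
          Algebra.smul_def c (quotRule K d p q), IsScalarTower.algebraMap_apply k A K]
        simp only [quotRule]
        rw [← mul_div_assoc, ← map_mul, Derivation.map_smul, Algebra.smul_def, Algebra.smul_def]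
        congr 2
        ring }
    (by
      intro a b
      obtain ⟨p, q, hq, rfl⟩ := exists_frac_eq A a
      obtain ⟨p', q', hq', rfl⟩ := exists_frac_eq A b
      have h0 : algebraMap A K q ≠ 0 := by simpa using hq
      have h0' : algebraMap A K q' ≠ 0 := by simpa using hq'
      have e : algebraMap A K p / algebraMap A K q * (algebraMap A K p' / algebraMap A K q') =
          algebraMap A K (p * p') / algebraMap A K (q * q') := by
        simp only [map_mul]
        field_simp
      change fracDerivFun K d _ = _ • fracDerivFun K d _ + _ • fracDerivFun K d _
      rw [e, fracDerivFun_div d _ _ hq, fracDerivFun_div d _ _ hq',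
        fracDerivFun_div d _ _ (mul_ne_zero hq hq')]
      simp only [quotRule, map_mul, map_add, map_sub, Derivation.leibniz, smul_eq_mul]
      field_simp
      ring)

theorem fracDeriv_div [Algebra k K] [IsScalarTower k A K] (d : Derivation k A A) (p q : A)
    (hq : q ≠ 0) :
    fracDeriv K d (algebraMap A K p / algebraMap A K q) =
      algebraMap A K (d p * q - p * d q) / algebraMap A K q ^ 2 :=
  fracDerivFun_div d p q hq

end FractionField

/-! ### Polynomials and rational functions in `n` variables -/

/-- The polynomial algebra `A = ℂ[x₁, …, xₙ]`. -/
abbrev Poly (n : ℕ) : Type := MvPolynomial (Fin n) ℂ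

/-- The rational function field `B = ℂ(x₁, …, xₙ)`. -/
abbrev RatFun (n : ℕ) : Type := FractionRing (Poly n)

/-- The inclusion of `A` in `B`. -/
abbrev toRat {n : ℕ} (p : Poly n) : RatFun n := algebraMap (Poly n) (RatFun n) p

theorem toRat_ne_zero {n : ℕ} {p : Poly n} (hp : p ≠ 0) : toRat p ≠ 0 := by
  simpa using hp

/-- The derivation `∂ⱼ = ∂/∂xⱼ` of `B` over `ℂ`. -/
def ratPderiv {n : ℕ} (j : Fin n) : Derivation ℂ (RatFun n) (RatFun n) :=
  fracDeriv (RatFun n) (MvPolynomial.pderiv j)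

theorem ratPderiv_div {n : ℕ} (j : Fin n) (p q : Poly n) (hq : q ≠ 0) :
    ratPderiv j (toRat p / toRat q) =
      toRat (MvPolynomial.pderiv j p * q - p * MvPolynomial.pderiv j q) / toRat q ^ 2 :=
  fracDeriv_div _ p q hq

/-- The Jacobian determinant `Jac(b₁, …, bₙ) = det (∂ⱼ bᵢ)`. -/
def jac {n : ℕ} (b : Fin n → RatFun n) : RatFun n :=
  (Matrix.of fun i j => ratPderiv j (b i)).det

/-! ### The bracket defined by `n - 2` rational functions; here `n = m + 2` -/

/-- Pairs `sᵢ, tᵢ` (`1 ≤ i ≤ m = n - 2`) of coprime polynomials in `n` variables with `tᵢ ≠ 0`,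
such that the rational functions `sᵢ / tᵢ` are algebraically independent over `ℂ`.
Coprime means: without a common factor that is not a unit. -/
structure JacobianData (m : ℕ) where
  s : Fin m → Poly (m + 2)
  t : Fin m → Poly (m + 2)
  t_ne_zero : ∀ i, t i ≠ 0
  coprime : ∀ i, IsRelPrime (s i) (t i)
  algebraicIndependent : AlgebraicIndependent ℂ fun i => toRat (s i) / toRat (t i)

variable {m : ℕ}

theorem JacobianData.s_ne_zero (D : JacobianData m) (i : Fin m) : D.s i ≠ 0 := by
  intro h
  apply D.algebraicIndependent.ne_zero i
  simp [h, toRat]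

/-- The bracket `{f, g} = (t₁ ⋯ tₙ₋₂)² Jac(f, g, s₁/t₁, …, sₙ₋₂/tₙ₋₂)` on `B`. -/
def JacobianData.bracket (D : JacobianData m) (f g : RatFun (m + 2)) : RatFun (m + 2) :=
  (∏ i, toRat (D.t i)) ^ 2 *
    jac (Fin.cons f (Fin.cons g fun i => toRat (D.s i) / toRat (D.t i)))

/-- The sequences `γ = ((γ₁, δ₁), …, (γₘ, δₘ))` in `{0,1} × {0,1}`. -/
abbrev Gam (m : ℕ) : Type := Fin m → Bool × Bool

/-- `γ` is dense: `(γᵢ, δᵢ) ≠ (0, 0)` for all `i`. -/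
def IsDense (γ : Gam m) : Prop := ∀ i, γ i ≠ (false, false)

/-- The set `S_γ`: it consists of the `sᵢ` with `γᵢ = 1` and the `tᵢ` with `δᵢ = 1`. -/
def JacobianData.S (D : JacobianData m) (γ : Gam m) : Set (Poly (m + 2)) :=
  {p | ∃ i, ((γ i).1 = true ∧ p = D.s i) ∨ ((γ i).2 = true ∧ p = D.t i)}

/-- The multiplicatively closed set `M_γ` generated by `S_γ`. -/
def JacobianData.M (D : JacobianData m) (γ : Gam m) : Submonoid (Poly (m + 2)) :=
  Submonoid.closure (D.S γ)

theorem JacobianData.M_le (D : JacobianData m) (γ : Gam m) :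
    D.M γ ≤ nonZeroDivisors (Poly (m + 2)) := by
  refine Submonoid.closure_le.2 ?_
  rintro p ⟨i, ⟨-, rfl⟩ | ⟨-, rfl⟩⟩
  · exact mem_nonZeroDivisors_of_ne_zero (D.s_ne_zero i)
  · exact mem_nonZeroDivisors_of_ne_zero (D.t_ne_zero i)

/-- The localization `A_γ = M_γ⁻¹ A`, as the subalgebra of all `a / u` with `a ∈ A` and `u ∈ M_γ`
of the field `B`. -/
abbrev JacobianData.Aloc (D : JacobianData m) (γ : Gam m) :
    Subalgebra (Poly (m + 2)) (RatFun (m + 2)) :=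
  Localization.subalgebra.ofField (RatFun (m + 2)) (D.M γ) (D.M_le γ)

theorem JacobianData.mem_Aloc (D : JacobianData m) (γ : Gam m) (x : RatFun (m + 2)) :
    x ∈ D.Aloc γ ↔ ∃ a u : Poly (m + 2), u ∈ D.M γ ∧ x = toRat a / toRat u := by
  change (∃ (a u : Poly (m + 2)) (_ : u ∈ D.M γ), x = toRat a * (toRat u)⁻¹) ↔ _
  simp only [div_eq_mul_inv, exists_prop]

theorem JacobianData.toRat_mem (D : JacobianData m) (γ : Gam m) (p : Poly (m + 2)) :
    toRat p ∈ D.Aloc γ :=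
  (D.Aloc γ).algebraMap_mem p

theorem JacobianData.ratPderiv_mem (D : JacobianData m) (γ : Gam m) (j : Fin (m + 2))
    {x : RatFun (m + 2)} (hx : x ∈ D.Aloc γ) : ratPderiv j x ∈ D.Aloc γ := by
  obtain ⟨a, u, hu, rfl⟩ := (D.mem_Aloc γ x).1 hx
  rw [ratPderiv_div j a u (nonZeroDivisors.ne_zero (D.M_le γ hu))]
  refine (D.mem_Aloc γ _).2
    ⟨MvPolynomial.pderiv j a * u - a * MvPolynomial.pderiv j u, u ^ 2, pow_mem hu 2, ?_⟩
  simp only [toRat, map_pow]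

theorem JacobianData.bracket_mem (D : JacobianData m) (γ : Gam m) {f g : RatFun (m + 2)}
    (hf : f ∈ D.Aloc γ) (hg : g ∈ D.Aloc γ) : D.bracket f g ∈ D.Aloc γ := by
  have e : D.bracket f g =
      (Matrix.of fun i j =>
        (Fin.cons 1 (Fin.cons 1 fun i => toRat (D.t i) ^ 2) : Fin (m + 2) → RatFun (m + 2)) i *
          (Matrix.of fun i j => ratPderiv j ((Fin.cons f (Fin.cons g fun i =>
            toRat (D.s i) / toRat (D.t i)) : Fin (m + 2) → RatFun (m + 2)) i)) i j).det := by
    rw [Matrix.det_mul_column, JacobianData.bracket, jac]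
    congr 1
    rw [Fin.prod_univ_succ, Fin.prod_univ_succ]
    simp [Finset.prod_pow]
  rw [e, Matrix.det_apply]
  refine Subalgebra.sum_mem _ fun σ _ => ?_
  rw [Units.smul_def]
  refine zsmul_mem (Subalgebra.prod_mem _ fun i _ => ?_) _
  generalize σ i = k
  simp only [Matrix.of_apply]
  refine Fin.cases ?_ (fun k => Fin.cases ?_ (fun l => ?_) k) k
  · simpa using D.ratPderiv_mem γ i hf
  · simpa using D.ratPderiv_mem γ i hg
  · simp only [Fin.cons_succ]
    rw [ratPderiv_div _ _ _ (D.t_ne_zero l),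
      mul_div_cancel₀ _ (pow_ne_zero 2 (toRat_ne_zero (D.t_ne_zero l)))]
    exact D.toRat_mem γ _

/-- The bracket of `A_γ`: the restriction of the bracket of `B`. -/
def JacobianData.bracketLoc (D : JacobianData m) (γ : Gam m) (f g : D.Aloc γ) : D.Aloc γ :=
  ⟨D.bracket f g, D.bracket_mem γ f.2 g.2⟩

/-- `vᵢ = sᵢ / tᵢ` if `δᵢ = 1`, and `vᵢ = tᵢ / sᵢ` otherwise. -/
def JacobianData.v (D : JacobianData m) (γ : Gam m) (i : Fin m) : RatFun (m + 2) :=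
  if (γ i).2 = true then toRat (D.s i) / toRat (D.t i) else toRat (D.t i) / toRat (D.s i)

theorem JacobianData.v_mem (D : JacobianData m) {γ : Gam m} (hγ : IsDense γ) (i : Fin m) :
    D.v γ i ∈ D.Aloc γ := by
  rw [D.mem_Aloc, JacobianData.v]
  split_ifs with h
  · exact ⟨_, _, Submonoid.subset_closure ⟨i, Or.inr ⟨h, rfl⟩⟩, rfl⟩
  · have h1 : (γ i).1 = true := by
      by_contra h1
      exact hγ i (Prod.ext (by simpa using h1) (by simpa using h))
    exact ⟨_, _, Submonoid.subset_closure ⟨i, Or.inl ⟨h1, rfl⟩⟩, rfl⟩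

/-- The `ℂ`-subalgebra `C_γ = ℂ[v₁, …, vₘ]` of `A_γ`, for `γ` dense. -/
abbrev JacobianData.C (D : JacobianData m) {γ : Gam m} (hγ : IsDense γ) :
    Subalgebra ℂ (D.Aloc γ) :=
  Algebra.adjoin ℂ (Set.range fun i => (⟨D.v γ i, D.v_mem hγ i⟩ : D.Aloc γ))

end PoissonSpectra

end

/-!
Write `S` for the localization `A_γ` and `ham g = {-, g}`, a derivation of `S`. The `vᵢ` are Casimirs:
`ham g` kills them all, hence kills `C_γ`.

An extended ideal `I S` is therefore Poisson. In characteristic zero a minimal prime over an ideal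
stable under a derivation is again stable (`Derivation.map_mem_of_mem_minimalPrimes`), so the minimal
primes over `I S` are Poisson, and a prime Poisson ideal is Poisson prime. The same fact, applied to
the finitely many minimal primes over a Poisson prime ideal of the Noetherian ring `S`, shows that a
Poisson prime ideal is prime (`IsPoissonPrime.isPrime`).

Let `Q` be a prime Poisson ideal that is not residually null, say `{f, g} ∉ Q`. Up to a factor in `S`,
the bracket `{f, g}` is the Jacobian determinant of `f, g, v₁, …, vₘ`, so this determinant is not
in `Q`. By the Jacobian criterion the map `R = ℂ[y₁, y₂, z₁, …, zₘ] → S` that sends the variables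
to `f, g, v₁, …, vₘ` becomes étale once the determinant is inverted. An étale map is flat, so it
satisfies going-down, and it is quasi-finite; thus `ht Q = ht (Q ∩ R)`
(`Ideal.height_eq_height_under_of_etale`), and flatness also gives the injectivity of `R → S`, so
that `ℂ[z₁, …, zₘ]` is a copy of `C_γ`. Through `R → S` the derivations `ham g` and `ham f` act on
`R` as `{f, g} ∂/∂y₁` and `-{f, g} ∂/∂y₂`. As they preserve `Q` and `{f, g} ∉ Q`, the prime `Q ∩ R`
is stable under both `∂/∂yᵢ`. In characteristic zero such an ideal is extended from `ℂ[z₁, …, zₘ]`,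
and extension to a polynomial ring preserves heights, whence `ht Q = ht (Q ∩ C_γ)`
(`Ideal.height_eq_height_comap_adjoin_casimirs`).

Finally, for such a `Q` choose a minimal prime `P ⊆ Q` over `(Q ∩ C_γ) S`. It is Poisson, is not
residually null because `Q` is not, and has the same contraction to `C_γ`; so `ht P = ht Q`
and `P = Q`.
-/

open MvPolynomial KaehlerDifferential

/-! ### Étale algebras and the Jacobian criterion -/

namespace Algebra

/-- The Jacobian criterion: if `S` is formally smooth over `k` and `Ω[S⁄k]` and `Ω[R⁄k]` are free of
the same finite rank, then `S` is formally étale over `R` when `S ⊗[R] Ω[R⁄k] → Ω[S⁄k]` has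
invertible determinant. Both `Ω[S⁄R]` and the first cotangent homology of `S` over `R` vanish by the
Jacobi–Zariski sequence. -/
theorem FormallyEtale.of_isUnit_det_kaehlerDifferential {k R S ι : Type*} [CommRing k] [CommRing R]
    [CommRing S] [Algebra k R] [Algebra R S] [Algebra k S] [IsScalarTower k R S]
    [Fintype ι] [DecidableEq ι] [FormallySmooth k S]
    (r : ι → R) (b : Module.Basis ι R Ω[R⁄k]) (hb : ∀ i, b i = D k R (r i))
    (c : Module.Basis ι S Ω[S⁄k])
    (h : IsUnit (Matrix.of fun i j => c.repr (D k S (algebraMap R S (r i))) j).det) :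
    FormallyEtale R S := by
  have hmat : LinearMap.toMatrix (b.baseChange S) c (mapBaseChange k R S) =
      (Matrix.of fun i j => c.repr (D k S (algebraMap R S (r i))) j).transpose := by
    ext i j
    simp [LinearMap.toMatrix_apply, hb]
  have hbij : Function.Bijective (mapBaseChange k R S) :=
    (LinearEquiv.ofIsUnitDet (f := mapBaseChange k R S) (v := b.baseChange S) (v' := c)
      (by rwa [hmat, Matrix.det_transpose])).bijective
  refine ⟨?_, ?_⟩
  · refine ⟨fun x y => ?_⟩
    have key : ∀ z : Ω[S⁄R], z = 0 := by
      intro z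
      obtain ⟨w, rfl⟩ := map_surjective_of_surjective k R S S Function.surjective_id z
      exact (exact_mapBaseChange_map k R S w).2 (hbij.2 w)
    rw [key x, key y]
  · refine ⟨fun x y => ?_⟩
    have hs : Subsingleton (H1Cotangent k S) := FormallySmooth.subsingleton_h1Cotangent
    have key : ∀ z : H1Cotangent R S, z = 0 := by
      intro z
      have h0 : H1Cotangent.δ k R S z = 0 :=
        hbij.1 (((H1Cotangent.exact_δ_mapBaseChange k R S _).2 ⟨z, rfl⟩).trans (map_zero _).symm)
      obtain ⟨w, rfl⟩ := (H1Cotangent.exact_map_δ k R S z).1 h0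
      rw [Subsingleton.elim w 0, map_zero]
    rw [key x, key y]

end Algebra

/-- If `S` is formally étale over the polynomial ring in the variables `xᵢ` over `k` (for instance a
localization of it), the differentials `d xᵢ` form a basis of `Ω[S⁄k]`. -/
noncomputable def KaehlerDifferential.basisOfFormallyEtale (k ι S : Type*) [CommRing k] [CommRing S]
    [Algebra k S] [Algebra (MvPolynomial ι k) S] [IsScalarTower k (MvPolynomial ι k) S]
    [Algebra.FormallyEtale (MvPolynomial ι k) S] : Module.Basis ι S Ω[S⁄k] :=
  (isBaseChange_of_formallyEtale k (MvPolynomial ι k) S).basis (mvPolynomialBasis k ι)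

theorem KaehlerDifferential.basisOfFormallyEtale_apply {k ι S : Type*} [CommRing k] [CommRing S]
    [Algebra k S] [Algebra (MvPolynomial ι k) S] [IsScalarTower k (MvPolynomial ι k) S]
    [Algebra.FormallyEtale (MvPolynomial ι k) S] (i : ι) :
    basisOfFormallyEtale k ι S i = D k S (algebraMap (MvPolynomial ι k) S (MvPolynomial.X i)) := by
  simp [basisOfFormallyEtale, IsBaseChange.basis_apply]

/-- The coordinates of `d f` are the partial derivatives `d j f`: a derivation of `S` is determined by
its values on the variables. -/
theorem KaehlerDifferential.basisOfFormallyEtale_repr {k ι S : Type*} [CommRing k] [CommRing S]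
    [Algebra k S] [Algebra (MvPolynomial ι k) S] [IsScalarTower k (MvPolynomial ι k) S]
    [Algebra.FormallyEtale (MvPolynomial ι k) S] [DecidableEq ι] (d : ι → Derivation k S S)
    (hd : ∀ i j, d j (algebraMap (MvPolynomial ι k) S (MvPolynomial.X i)) = if i = j then 1 else 0)
    (f : S) (j : ι) :
    (basisOfFormallyEtale k ι S).repr (D k S f) j = d j f := by
  have : (basisOfFormallyEtale k ι S).coord j = (d j).liftKaehlerDifferential := by
    refine (basisOfFormallyEtale k ι S).ext fun i => ?_
    rw [Module.Basis.coord_apply, Module.Basis.repr_self, basisOfFormallyEtale_apply,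
      Derivation.liftKaehlerDifferential_comp_D, hd, Finsupp.single_apply]
  have h2 := LinearMap.congr_fun this (D k S f)
  rwa [Derivation.liftKaehlerDifferential_comp_D] at h2

/-- Étale algebras satisfy going-down, as they are flat, and have zero-dimensional fibres, as they are
quasi-finite; so they preserve heights. -/
theorem Ideal.height_eq_height_under_of_etale {R S : Type*} [CommRing R] [CommRing S] [Algebra R S]
    [IsNoetherianRing R] [IsNoetherianRing S] [Algebra.Etale R S] (Q : Ideal S) [Q.IsPrime] :
    Q.height = (Q.under R).height := by
  have hle : (Q.under R).map (algebraMap R S) ≤ Q := Ideal.map_comap_le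
  have hker : RingHom.ker (Ideal.Quotient.mk ((Q.under R).map (algebraMap R S))) ≤ Q := by
    rwa [Ideal.mk_ker]
  have hp := Ideal.map_isPrime_of_surjective Ideal.Quotient.mk_surjective hker
  rw [Ideal.height_eq_height_add_of_liesOver_of_hasGoingDown (Q.under R) Q]
  suffices h : (Q.map (Ideal.Quotient.mk ((Q.under R).map (algebraMap R S)))).height = 0 by
    rw [h, add_zero]
  rw [Ideal.height_eq_zero_iff]
  refine ⟨⟨hp, bot_le⟩, ?_⟩
  rintro P ⟨hP, -⟩ hPQ
  have h1 : P.comap (Ideal.Quotient.mk _) ≤ Q := by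
    refine (Ideal.comap_mono hPQ).trans ?_
    rw [Ideal.comap_map_of_surjective' _ Ideal.Quotient.mk_surjective]
    exact sup_le le_rfl hker
  have h2 : (P.comap (Ideal.Quotient.mk ((Q.under R).map (algebraMap R S)))).under R =
      Q.under R := by
    refine le_antisymm (Ideal.comap_mono h1) fun x hx => ?_
    change Ideal.Quotient.mk _ (algebraMap R S x) ∈ P
    rw [Ideal.Quotient.eq_zero_iff_mem.2 (Ideal.mem_map_of_mem _ hx)]
    exact P.zero_mem
  have h3 := Algebra.QuasiFinite.eq_of_le_of_under_eq _ _ h1 h2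
  rw [Ideal.map_le_iff_le_comap]
  exact h3.ge

/-- The Jacobian criterion on the principal open set where the Jacobian determinant `u` is
invertible. -/
theorem Algebra.etale_away_of_det_kaehlerDifferential {k R S ι : Type*} [Field k] [CommRing R]
    [CommRing S] [Algebra k R] [Algebra R S] [Algebra k S] [IsScalarTower k R S]
    [IsNoetherianRing R] [Fintype ι] [DecidableEq ι] [FormallySmooth k S] [FiniteType k S]
    (r : ι → R) (b : Module.Basis ι R Ω[R⁄k]) (hb : ∀ i, b i = D k R (r i))
    (c : Module.Basis ι S Ω[S⁄k]) (u : S)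
    (hu : u = (Matrix.of fun i j => c.repr (D k S (algebraMap R S (r i))) j).det) :
    Etale R (Localization.Away u) := by
  let T := Localization.Away u
  have : FormallyEtale S T := .of_isLocalization (Submonoid.powers u)
  have : FormallySmooth k T := .comp k S T
  have : FiniteType S T := IsLocalization.finiteType_of_monoid_fg (Submonoid.powers u) T
  have : FiniteType k T := .trans ‹FiniteType k S› ‹_›
  have : FiniteType R T := .of_restrictScalars_finiteType k R T
  let hbc := isBaseChange_of_formallyEtale k S T
  refine ⟨?_, FinitePresentation.of_finiteType.1 this⟩
  refine .of_isUnit_det_kaehlerDifferential (k := k) r b hb (hbc.basis c) ?_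
  have e : (Matrix.of fun i j => (hbc.basis c).repr (D k T (algebraMap R T (r i))) j) =
      (algebraMap S T).mapMatrix
        (Matrix.of fun i j => c.repr (D k S (algebraMap R S (r i))) j) := by
    ext i j
    have e1 : D k T (algebraMap R T (r i)) =
        KaehlerDifferential.map k k S T (D k S (algebraMap R S (r i))) := by
      simp [IsScalarTower.algebraMap_apply R S T]
    rw [Matrix.of_apply, e1, IsBaseChange.basis_repr_comp_apply]
    rfl
  rw [e, ← RingHom.map_det, ← hu]
  exact IsLocalization.Away.algebraMap_isUnit u

theorem Ideal.height_eq_height_under_of_etale_away {R S : Type*} [CommRing R] [CommRing S]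
    [Algebra R S] [IsNoetherianRing R] [IsNoetherianRing S] (u : S)
    [Algebra.Etale R (Localization.Away u)] (Q : Ideal S) [Q.IsPrime] (hu : u ∉ Q) :
    Q.height = (Q.under R).height := by
  let T := Localization.Away u
  have : IsNoetherianRing T := IsLocalization.isNoetherianRing (Submonoid.powers u) T inferInstance
  have hd : Disjoint (Submonoid.powers u : Set S) (Q : Set S) :=
    (Ideal.disjoint_powers_iff_notMem_of_isPrime u).2 hu
  have hp : (Q.map (algebraMap S T)).IsPrime :=
    IsLocalization.isPrime_of_isPrime_disjoint (Submonoid.powers u) T Q ‹_› hd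
  have hcomap : (Q.map (algebraMap S T)).under S = Q :=
    IsLocalization.under_map_of_isPrime_disjoint (Submonoid.powers u) T ‹_› hd
  rw [← IsLocalization.height_map_of_disjoint (S := T) (Submonoid.powers u) Q hd,
    Ideal.height_eq_height_under_of_etale (R := R), ← Ideal.under_under (B := S), hcomap]

theorem Algebra.injective_algebraMap_of_etale_away {R S : Type*} [CommRing R] [IsDomain R]
    [CommRing S] [IsDomain S] [Algebra R S] (u : S) (hu : u ≠ 0)
    [Algebra.Etale R (Localization.Away u)] : Function.Injective (algebraMap R S) := by
  let T := Localization.Away u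
  have : IsDomain T := IsLocalization.isDomain_localization
    (powers_le_nonZeroDivisors_of_noZeroDivisors hu)
  have h : Function.Injective (algebraMap R T) := FaithfulSMul.algebraMap_injective R T
  rw [IsScalarTower.algebraMap_eq R S T, RingHom.coe_comp] at h
  exact Function.Injective.of_comp h

/-! ### Poisson prime ideals and minimal primes -/

/-- In characteristic zero, a minimal prime over an ideal stable under a derivation is stable under
that derivation. -/
theorem Derivation.map_mem_of_mem_minimalPrimes {k S : Type*} [Field k] [CharZero k] [CommRing S]
    [Algebra k S] (d : Derivation k S S) {I P : Ideal S} (hI : ∀ x ∈ I, d x ∈ I)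
    (hP : P ∈ I.minimalPrimes) {x : S} (hx : x ∈ P) : d x ∈ P := by
  have hprime : P.IsPrime := hP.1.1
  -- Differentiating `x ^ (n + 1) * (d x) ^ e * y ∈ I` and multiplying by `d x * y` trades one factor
  -- `x` for two factors `d x`; the other terms of the product rule are multiples of the element itself.
  have key : ∀ (n e : ℕ) (y : S), y ∉ P → x ^ n * (d x) ^ e * y ∈ I → d x ∈ P := by
    intro n
    induction n with
    | zero =>
      intro e y hy h
      rw [pow_zero, one_mul] at h
      exact hprime.mem_of_pow_mem e ((hprime.mem_or_mem (hP.1.2 h)).resolve_right hy)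
    | succ n ih =>
      intro e y hy h
      refine ih (e + 2) (y * y) (fun h' => (hprime.mem_or_mem h').elim hy hy) ?_
      have h1 : d (x ^ (n + 1) * d x ^ e * y) * (d x * y) ∈ I := I.mul_mem_right _ (hI _ h)
      have h2 : (n + 1 : S) * (x ^ n * d x ^ (e + 2) * (y * y)) ∈ I := by
        have h3 := I.sub_mem h1 (I.mul_mem_right (e * d (d x) * y + d x * d y) h)
        convert! h3 using 1
        rcases e with _ | e
        · simp only [Derivation.leibniz, Derivation.leibniz_pow, smul_eq_mul, nsmul_eq_mul,
            Nat.add_sub_cancel, Nat.cast_add, Nat.cast_one]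
          simp
          ring
        · simp only [Derivation.leibniz, Derivation.leibniz_pow, smul_eq_mul, nsmul_eq_mul,
            Nat.add_sub_cancel, Nat.cast_add, Nat.cast_one]
          ring
      have h4 := I.mul_mem_left (algebraMap k S (n + 1 : k)⁻¹) h2
      rwa [← mul_assoc, show (n + 1 : S) = algebraMap k S (n + 1 : k) by simp, ← map_mul,
        inv_mul_cancel₀ (Nat.cast_add_one_ne_zero n), map_one, one_mul] at h4
  have hx' : algebraMap S (Localization.AtPrime P) x ∈
      (I.map (algebraMap S (Localization.AtPrime P))).radical := by
    rw [IsLocalization.AtPrime.radical_map_of_mem_minimalPrimes (Localization.AtPrime P) P I hP]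
    exact Ideal.mem_map_of_mem _ hx
  obtain ⟨n, hn⟩ := hx'
  rw [← map_pow, IsLocalization.algebraMap_mem_map_algebraMap_iff P.primeCompl] at hn
  obtain ⟨y, hy, h⟩ := hn
  exact key n 0 y hy (by simpa [mul_comm] using h)

namespace PoissonSpectra

section

variable {k S : Type*} [Field k] [CommRing S] [Algebra k S]
  {br : S → S → S} (d : S → Derivation k S S) (hbr : ∀ f g, br f g = d g f)

include hbr

theorem IsPoissonIdeal.mul {I J : Ideal S} (hI : IsPoissonIdeal br I) (hJ : IsPoissonIdeal br J) :
    IsPoissonIdeal br (I * J) := by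
  intro x hx r
  rw [hbr]
  induction hx using Submodule.mul_induction_on' with
  | mem_mul_mem a ha b hb =>
    rw [Derivation.leibniz, smul_eq_mul, smul_eq_mul, mul_comm b]
    exact add_mem (Ideal.mul_mem_mul ha (hbr b r ▸ hJ b hb r))
      (Ideal.mul_mem_mul (hbr a r ▸ hI a ha r) hb)
  | add a _ b _ ha hb => rw [map_add]; exact add_mem ha hb

theorem IsPoissonPrime.exists_mem_le_of_multiset_prod_le {Q : Ideal S} (hQ : IsPoissonPrime br Q)
    (s : Multiset (Ideal S)) (hs : ∀ J ∈ s, IsPoissonIdeal br J) (h : s.prod ≤ Q) :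
    ∃ J ∈ s, J ≤ Q := by
  have hprod : ∀ s : Multiset (Ideal S), (∀ J ∈ s, IsPoissonIdeal br J) →
      IsPoissonIdeal br s.prod := by
    intro s
    induction s using Multiset.induction_on with
    | empty => intro _ _ _ _; simp
    | cons a s ih =>
      intro hs
      rw [Multiset.prod_cons]
      exact (hs a (Multiset.mem_cons_self a s)).mul d hbr
        (ih fun J hJ => hs J (Multiset.mem_cons_of_mem hJ))
  induction s using Multiset.induction_on with
  | empty => exact absurd (top_le_iff.1 (by simpa using h)) hQ.2.1
  | cons a s ih =>
    rw [Multiset.prod_cons] at h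
    have hs' : ∀ J ∈ s, IsPoissonIdeal br J := fun J hJ => hs J (Multiset.mem_cons_of_mem hJ)
    rcases hQ.2.2 _ _ (hs a (Multiset.mem_cons_self a s)) (hprod s hs') h with h1 | h1
    · exact ⟨a, Multiset.mem_cons_self a s, h1⟩
    · obtain ⟨J, hJ, hJQ⟩ := ih hs' h1
      exact ⟨J, Multiset.mem_cons_of_mem hJ, hJQ⟩

variable [CharZero k]

theorem IsPoissonIdeal.of_mem_minimalPrimes {I P : Ideal S} (hI : IsPoissonIdeal br I)
    (hP : P ∈ I.minimalPrimes) : IsPoissonIdeal br P := fun x hx r =>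
  hbr x r ▸ (d r).map_mem_of_mem_minimalPrimes (fun y hy => hbr y r ▸ hI y hy r) hP hx

theorem IsPoissonPrime.of_mem_minimalPrimes {I P : Ideal S} (hI : IsPoissonIdeal br I)
    (hP : P ∈ I.minimalPrimes) : IsPoissonPrime br P :=
  ⟨hI.of_mem_minimalPrimes d hbr hP, hP.1.1.ne_top, fun _ _ _ _ h => hP.1.1.mul_le.1 h⟩

/-- In a Noetherian ring some product of the minimal primes over `Q`, which are Poisson ideals, lies in
`Q`; so a Poisson prime ideal `Q` contains one of them. -/
theorem IsPoissonPrime.isPrime [IsNoetherianRing S] {Q : Ideal S} (hQ : IsPoissonPrime br Q) :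
    Q.IsPrime := by
  have hfin := Q.finite_minimalPrimes_of_isNoetherianRing
  obtain ⟨n, hn⟩ := Q.exists_radical_pow_le_of_fg (IsNoetherian.noetherian _)
  have hle : (n • hfin.toFinset.val).prod ≤ Q := by
    rw [Multiset.prod_nsmul]
    refine (Ideal.pow_right_mono ?_ n).trans hn
    rw [← Ideal.sInf_minimalPrimes]
    refine le_sInf fun P hP => ?_
    exact Ideal.le_of_dvd (Multiset.dvd_prod (by simpa using hP))
  obtain ⟨P, hP, hPQ⟩ := hQ.exists_mem_le_of_multiset_prod_le d hbr _
    (fun J hJ => hQ.1.of_mem_minimalPrimes d hbr (by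
      simpa using Multiset.mem_of_mem_nsmul hJ)) hle
  have hP' : P ∈ Q.minimalPrimes := by simpa using Multiset.mem_of_mem_nsmul hP
  exact le_antisymm hPQ hP'.1.2 ▸ hP'.1.1

end

end PoissonSpectra

/-! ### Ideals of polynomial rings stable under partial derivatives -/

namespace MvPolynomial

/-- An ideal stable under all `∂/∂Xᵢ` contains the coefficients of its elements, in characteristic zero:
a nonconstant coefficient is, up to a nonzero integer, a coefficient of a partial derivative, whose
degree is smaller. -/
theorem C_coeff_mem_of_pderiv_mem (k : Type*) {σ R : Type*} [Field k] [CharZero k] [CommRing R]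
    [Algebra k R]
    {P : Ideal (MvPolynomial σ R)} (hP : ∀ i, ∀ f ∈ P, pderiv i f ∈ P)
    {f : MvPolynomial σ R} (hf : f ∈ P) (n : σ →₀ ℕ) : C (coeff n f) ∈ P := by
  classical
  have key : ∀ (N : ℕ) (f : MvPolynomial σ R), f ∈ P → (∀ n ∈ f.support, n.degree < N) →
      ∀ n, C (coeff n f) ∈ P := by
    intro N
    induction N with
    | zero =>
      intro f hf hN n
      rw [notMem_support_iff.1 fun hn => Nat.not_lt_zero _ (hN n hn), C_0]
      exact P.zero_mem
    | succ N ih =>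
      intro f hf hN
      have hpos : ∀ n : σ →₀ ℕ, n ≠ 0 → C (coeff n f) ∈ P := by
        intro n hn
        obtain ⟨i, hi⟩ := Finsupp.ne_iff.1 hn
        have hle : Finsupp.single i 1 ≤ n := by
          rw [Finsupp.single_le_iff]
          exact Nat.one_le_iff_ne_zero.2 hi
        obtain ⟨l, rfl⟩ := exists_add_of_le hle
        have hdeg : ∀ n ∈ (pderiv i f).support, n.degree < N := by
          intro n hn
          rw [mem_support_iff, coeff_pderiv] at hn
          have := hN _ (mem_support_iff.2 (left_ne_zero_of_mul hn))
          rw [map_add, Finsupp.degree_single] at this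
          omega
        have h := ih _ (hP i f hf) hdeg l
        rw [coeff_pderiv, add_comm l] at h
        have h' := P.mul_mem_left (C (algebraMap k R (l i + 1 : k)⁻¹)) h
        rwa [← C_mul, mul_comm, mul_assoc, show ((l i : R) + 1) = algebraMap k R (l i + 1) by simp,
          ← map_mul, mul_inv_cancel₀ (Nat.cast_add_one_ne_zero _), map_one, mul_one] at h'
      intro n
      by_cases hn : n = 0
      · subst hn
        have e : C (coeff 0 f) = f - ∑ n ∈ f.support.erase 0, C (coeff n f) * monomial n 1 := by
          have h := f.support_sum_monomial_coeff
          by_cases h0 : (0 : σ →₀ ℕ) ∈ f.support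
          · rw [← Finset.add_sum_erase _ _ h0] at h
            rw [eq_sub_iff_add_eq]
            simp only [C_mul_monomial, mul_one]
            exact h
          · rw [Finset.erase_eq_of_notMem h0, notMem_support_iff.1 h0]
            simp only [C_mul_monomial, mul_one, h, C_0, sub_self]
        rw [e]
        refine sub_mem hf (sum_mem fun n hn => P.mul_mem_right _ (hpos n ?_))
        exact Finset.ne_of_mem_erase hn
      · exact hpos n hn
  exact key _ f hf (fun n hn => Nat.lt_succ_of_le (Finset.le_sup (f := Finsupp.degree) hn)) n

theorem map_C_comap_C_eq_of_pderiv_mem (k : Type*) {σ R : Type*} [Field k] [CharZero k] [CommRing R]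
    [Algebra k R]
    {P : Ideal (MvPolynomial σ R)} (hP : ∀ i, ∀ f ∈ P, pderiv i f ∈ P) :
    (P.comap C).map C = P :=
  le_antisymm Ideal.map_comap_le fun _ hf =>
    mem_map_C_iff.2 fun n => C_coeff_mem_of_pderiv_mem k hP hf n

theorem height_eq_height_comap_C_of_pderiv_mem (k : Type*) {σ R : Type*} [Field k] [CharZero k]
    [Finite σ] [CommRing R] [IsNoetherianRing R] [Algebra k R] {P : Ideal (MvPolynomial σ R)} [P.IsPrime]
    (hP : ∀ i, ∀ f ∈ P, pderiv i f ∈ P) : P.height = (P.comap C).height := by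
  have h := Ideal.height_eq_height_add_of_liesOver_of_hasGoingDown (P.under R) P
  have e : (P.under R).map (algebraMap R (MvPolynomial σ R)) = P :=
    map_C_comap_C_eq_of_pderiv_mem k hP
  have h0 : (P.map (Ideal.Quotient.mk ((P.under R).map (algebraMap R (MvPolynomial σ R))))) = ⊥ := by
    rw [Ideal.map_eq_bot_iff_le_ker, Ideal.mk_ker, e]
  have : IsDomain (MvPolynomial σ R ⧸ (P.under R).map (algebraMap R (MvPolynomial σ R))) := by
    rw [e]; infer_instance
  rw [h0, Ideal.height_bot, add_zero] at h
  exact h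

end MvPolynomial

/-! ### Heights and rings of Casimirs -/

/-- A derivation that vanishes on all the `x j` except `x i` acts on the polynomials in the `x j` as a
multiple of the partial derivative with respect to the `i`-th variable. -/
theorem Derivation.aeval_eq_mul_pderiv {k S σ : Type*} [CommRing k] [CommRing S] [Algebra k S]
    [DecidableEq σ] (d : Derivation k S S) (x : σ → S) (i : σ) (u : S)
    (h : ∀ j, d (x j) = if j = i then u else 0) (f : MvPolynomial σ k) :
    d (aeval x f) = u * aeval x (pderiv i f) := by
  induction f using MvPolynomial.induction_on with
  | C a => simp
  | add p q hp hq => simp only [map_add, hp, hq, mul_add]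
  | mul_X p j hp =>
    simp only [map_mul, aeval_X, Derivation.leibniz, smul_eq_mul, hp, h, pderiv_X, Pi.single_apply,
      map_add]
    by_cases hj : j = i
    · simp [hj]; ring
    · simp [hj]; ring

/-- Suppose that the Jacobian determinant of the elements `x i` and `v j` of `S`, as many as the rank of
`Ω[S⁄k]`, is not in the prime `Q`. If `Q` is stable under derivations `d i` that vanish on all these
elements except on `x i`, where the value `w i` is not in `Q`, then `Q` has the same height as
its contraction to the polynomial ring in the `v j`. -/
theorem MvPolynomial.height_eq_height_comap_aeval {k S σ τ : Type*} [Field k] [CharZero k]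
    [Fintype σ] [DecidableEq σ] [Fintype τ] [DecidableEq τ]
    [CommRing S] [IsDomain S] [Algebra k S] [Algebra.FiniteType k S] [Algebra.FormallySmooth k S]
    (c : Module.Basis (σ ⊕ τ) S Ω[S⁄k]) (x : σ → S) (v : τ → S) (Q : Ideal S) [Q.IsPrime]
    (hdet : (Matrix.of fun i j => c.repr (D k S (Sum.elim x v i)) j).det ∉ Q)
    (d : σ → Derivation k S S) (hdQ : ∀ i, ∀ f ∈ Q, d i f ∈ Q) (hdv : ∀ i j, d i (v j) = 0)
    (w : σ → S) (hw : ∀ i, w i ∉ Q) (hdx : ∀ i j, d i (x j) = if j = i then w i else 0) :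
    AlgebraicIndependent k v ∧ Q.height = (Q.comap (aeval (R := k) v)).height := by
  have hnoeth : IsNoetherianRing S := Algebra.FiniteType.isNoetherianRing k S
  let φ : MvPolynomial (σ ⊕ τ) k →ₐ[k] S := aeval (Sum.elim x v)
  let := φ.toRingHom.toAlgebra
  have : IsScalarTower k (MvPolynomial (σ ⊕ τ) k) S := .of_algebraMap_eq' φ.comp_algebraMap.symm
  set u := (Matrix.of fun i j => c.repr (D k S (Sum.elim x v i)) j).det with hu
  have hetale : Algebra.Etale (MvPolynomial (σ ⊕ τ) k) (Localization.Away u) := by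
    refine Algebra.etale_away_of_det_kaehlerDifferential (k := k) X (mvPolynomialBasis k _)
      (mvPolynomialBasis_apply k _) c u ?_
    rw [hu]
    have e (i : σ ⊕ τ) : algebraMap (MvPolynomial (σ ⊕ τ) k) S (X i) = Sum.elim x v i :=
      aeval_X (R := k) (Sum.elim x v) i
    simp only [e]
  have hφ (p : MvPolynomial τ k) : φ (rename Sum.inr p) = aeval v p := by
    simp [φ, aeval_rename, Function.comp_def]
  have hinj : Function.Injective φ := Algebra.injective_algebraMap_of_etale_away u
    fun h => hdet (h ▸ Q.zero_mem)
  refine ⟨fun p q h => rename_injective _ Sum.inr_injective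
    (hinj (by rw [hφ, hφ]; exact h)), ?_⟩
  let ψ := sumAlgEquiv k σ τ
  let P := (Q.comap φ).comap ψ.symm
  have hP : ∀ i, ∀ f ∈ P, pderiv i f ∈ P := by
    intro i f hf
    obtain ⟨g, rfl⟩ := ψ.surjective f
    have hg : φ g ∈ Q := by simpa [P] using hf
    have h1 := hdQ i _ hg
    rw [Derivation.aeval_eq_mul_pderiv (d i) _ (Sum.inl i) (w i)] at h1
    · have h2 := (Ideal.IsPrime.mem_or_mem ‹_› h1).resolve_left (hw i)
      have e : pderiv i (ψ g) = ψ (pderiv (Sum.inl i) g) := (pderiv_sumAlgEquiv ..)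
      rw [e]
      change φ (ψ.symm (ψ _)) ∈ Q
      rwa [AlgEquiv.symm_apply_apply]
    · rintro (j | j)
      · simp [hdx]
      · simp [hdv]
  have hPp : P.IsPrime := inferInstance
  have h1 : Q.height = (Q.comap φ).height := Ideal.height_eq_height_under_of_etale_away u Q hdet
  have h2 : P.height = (Q.comap φ).height := RingEquiv.height_comap ψ.symm.toRingEquiv _
  rw [h1, ← h2, height_eq_height_comap_C_of_pderiv_mem k hP]
  congr 1
  ext p
  change φ (ψ.symm (C p)) ∈ Q ↔ aeval v p ∈ Q
  have e : ψ (rename Sum.inr p) = C p := DFunLike.congr_fun (sumAlgEquiv_comp_rename_inr k σ τ) p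
  rw [← hφ, ← e, AlgEquiv.symm_apply_apply]

/-- Heights and Casimirs: `ham g` stands for the derivation `{-, g}` of a skew-symmetric biderivation
of `S`, and the `v i`, two fewer than the rank of `Ω[S⁄k]`, are Casimirs. A stable prime `Q` that
contains neither `{f, g}` nor the Jacobian determinant of `f`, `g` and the `v i` has the
same height as its contraction to the algebra generated by the `v i`. -/
theorem Ideal.height_eq_height_comap_adjoin_casimirs {k S τ : Type*} [Field k] [CharZero k]
    [Fintype τ] [DecidableEq τ] [CommRing S] [IsDomain S] [Algebra k S] [Algebra.FiniteType k S]
    [Algebra.FormallySmooth k S] (c : Module.Basis (Fin 2 ⊕ τ) S Ω[S⁄k]) (v : τ → S)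
    (ham : S → Derivation k S S) (hself : ∀ f, ham f f = 0) (hskew : ∀ f g, ham f g = -ham g f)
    (hv : ∀ g i, ham g (v i) = 0) (f g : S) (Q : Ideal S) [Q.IsPrime]
    (hQ : ∀ g, ∀ f ∈ Q, ham g f ∈ Q) (hfg : ham g f ∉ Q)
    (hdet : (Matrix.of fun i j => c.repr (D k S (Sum.elim ![f, g] v i)) j).det ∉ Q) :
    Q.height = (Q.comap (algebraMap (Algebra.adjoin k (Set.range v)) S)).height := by
  obtain ⟨hind, hht⟩ := MvPolynomial.height_eq_height_comap_aeval c ![f, g] v Q hdet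
    ![ham g, ham f]
    (by
      intro i a ha
      fin_cases i
      · exact hQ g a ha
      · exact hQ f a ha)
    (by
      intro i j
      fin_cases i
      · exact hv g j
      · exact hv f j)
    ![ham g f, -ham g f]
    (by
      intro i
      fin_cases i
      · exact hfg
      · exact fun h => hfg (neg_mem_iff.1 h))
    (by
      intro i j
      fin_cases i <;> fin_cases j
      · rfl
      · exact hself g
      · exact hself f
      · exact hskew f g)
  rw [hht]
  exact RingEquiv.height_comap hind.aevalEquiv.toRingEquiv
    (Q.comap (algebraMap (Algebra.adjoin k (Set.range v)) S))

/-! ### The Jacobian bracket as a family of derivations -/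

namespace Matrix

variable {K : Type*} [CommRing K] {m : ℕ}

theorem det_cons_eq_sum (a : Fin (m + 1) → K) (r : Fin m → Fin (m + 1) → K) :
    (of (Fin.cons a r : Fin (m + 1) → Fin (m + 1) → K)).det =
      ∑ j, a j * ((-1) ^ (j : ℕ) * (of fun i l => r i (j.succAbove l)).det) := by
  rw [det_succ_row_zero]
  refine Finset.sum_congr rfl fun j _ => ?_
  rw [of_apply, Fin.cons_zero, mul_left_comm, mul_assoc]
  rfl

theorem det_cons_cons_swap (a b : Fin (m + 2) → K) (r : Fin m → Fin (m + 2) → K) :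
    (of (Fin.cons a (Fin.cons b r) : Fin (m + 2) → Fin (m + 2) → K)).det =
      -(of (Fin.cons b (Fin.cons a r) : Fin (m + 2) → Fin (m + 2) → K)).det := by
  have h := det_permute (Equiv.swap (0 : Fin (m + 2)) 1)
    (of (Fin.cons b (Fin.cons a r) : Fin (m + 2) → Fin (m + 2) → K))
  rw [Equiv.Perm.sign_swap (by simp)] at h
  simp only [Units.val_neg, Units.val_one, Int.cast_neg, Int.cast_one, neg_mul, one_mul] at h
  rw [← h]
  congr 1
  ext i j
  refine Fin.cases ?_ (fun i => Fin.cases ?_ (fun i => ?_) i) i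
  · simp
  · simp
  · rw [submatrix_apply, Equiv.swap_apply_of_ne_of_ne]
    · rfl
    · exact Fin.succ_ne_zero _
    · exact fun h => Fin.succ_ne_zero i (Fin.succ_injective _ h)

theorem det_cons_cons_mul (a b : Fin (m + 2) → K) (c : Fin m → K) (r : Fin m → Fin (m + 2) → K) :
    (of (Fin.cons a (Fin.cons b fun i j => c i * r i j) : Fin (m + 2) → Fin (m + 2) → K)).det =
      (∏ i, c i) * (of (Fin.cons a (Fin.cons b r) : Fin (m + 2) → Fin (m + 2) → K)).det := by
  have h := det_mul_column (Fin.cons 1 (Fin.cons 1 c) : Fin (m + 2) → K)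
    (of (Fin.cons a (Fin.cons b r) : Fin (m + 2) → Fin (m + 2) → K))
  rw [Fin.prod_univ_succ, Fin.prod_univ_succ] at h
  simp only [Fin.cons_zero, Fin.cons_succ, one_mul] at h
  rw [← h]
  congr 1
  ext i j
  refine Fin.cases ?_ (fun i => Fin.cases ?_ (fun i => ?_) i) i <;> simp

end Matrix

namespace PoissonSpectra

variable {m : ℕ} (D : JacobianData m) (γ : Gam m)

/-- The derivation `∂ⱼ` of `A_γ`: the restriction of that of `B`. -/
noncomputable def JacobianData.pderivLoc (j : Fin (m + 2)) :
    Derivation ℂ (D.Aloc γ) (D.Aloc γ) :=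
  Derivation.mk'
    { toFun := fun f => ⟨ratPderiv j f, D.ratPderiv_mem γ j f.2⟩
      map_add' := fun f g => Subtype.ext (map_add (ratPderiv j) (f : RatFun (m + 2)) g)
      map_smul' := fun c f => Subtype.ext ((ratPderiv j).map_smul c (f : RatFun (m + 2))) }
    fun f g => Subtype.ext ((ratPderiv j).leibniz (f : RatFun (m + 2)) g)

theorem ratPderiv_toRat {n : ℕ} (j : Fin n) (p : Poly n) :
    ratPderiv j (toRat p) = toRat (pderiv j p) := by
  simpa [toRat] using ratPderiv_div j p 1 one_ne_zero

theorem JacobianData.pderivLoc_algebraMap_X (i j : Fin (m + 2)) :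
    D.pderivLoc γ j (algebraMap (Poly (m + 2)) (D.Aloc γ) (X i)) = if i = j then 1 else 0 := by
  refine Subtype.ext ?_
  change ratPderiv j (toRat (X i)) = _
  rw [ratPderiv_toRat, pderiv_X, Pi.single_apply]
  split_ifs <;> simp_all [toRat]

theorem jac_cons_cons (f g : RatFun (m + 2)) (x : Fin m → RatFun (m + 2)) :
    jac (Fin.cons f (Fin.cons g x)) = (Matrix.of (Fin.cons (fun j => ratPderiv j f)
      (Fin.cons (fun j => ratPderiv j g) fun i j => ratPderiv j (x i)) :
        Fin (m + 2) → Fin (m + 2) → RatFun (m + 2))).det := by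
  rw [jac]
  congr 1
  ext i j
  refine Fin.cases ?_ (fun i => Fin.cases ?_ (fun i => ?_) i) i <;> simp

/-- The derivation `{-, g}` of `B`, obtained by expanding the Jacobian determinant along its first
row. -/
noncomputable def JacobianData.hamiltonian (g : RatFun (m + 2)) :
    Derivation ℂ (RatFun (m + 2)) (RatFun (m + 2)) :=
  ∑ j : Fin (m + 2), ((∏ i, toRat (D.t i)) ^ 2 * ((-1) ^ (j : ℕ) *
    (Matrix.of fun i l => (Fin.cons (fun j => ratPderiv j g)
      (fun i j => ratPderiv j (toRat (D.s i) / toRat (D.t i))) :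
        Fin (m + 1) → Fin (m + 2) → RatFun (m + 2)) i (j.succAbove l)).det)) • ratPderiv j

theorem JacobianData.hamiltonian_apply (f g : RatFun (m + 2)) :
    D.hamiltonian g f = D.bracket f g := by
  rw [JacobianData.bracket, jac_cons_cons, Matrix.det_cons_eq_sum, Finset.mul_sum,
    JacobianData.hamiltonian, ← Derivation.coeFnAddMonoidHom_apply, map_sum, Finset.sum_apply]
  refine Finset.sum_congr rfl fun j _ => ?_
  rw [Derivation.coeFnAddMonoidHom_apply, Derivation.smul_apply, smul_eq_mul]
  ring

/-- The derivation `{-, g}` of `A_γ`. -/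
noncomputable def JacobianData.hamiltonianLoc (g : D.Aloc γ) :
    Derivation ℂ (D.Aloc γ) (D.Aloc γ) :=
  Derivation.mk'
    { toFun := fun f => D.bracketLoc γ f g
      map_add' := fun f f' => Subtype.ext (by
        simp only [JacobianData.bracketLoc, ← D.hamiltonian_apply]
        exact map_add (D.hamiltonian g) (f : RatFun (m + 2)) f')
      map_smul' := fun c f => Subtype.ext (by
        simp only [JacobianData.bracketLoc, ← D.hamiltonian_apply]
        exact (D.hamiltonian g).map_smul c (f : RatFun (m + 2))) }
    fun f f' => Subtype.ext (by
      change D.bracket _ _ = _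
      simp only [← D.hamiltonian_apply]
      refine ((D.hamiltonian g).leibniz (f : RatFun (m + 2)) f').trans ?_
      simp only [D.hamiltonian_apply]
      rfl)

theorem JacobianData.bracketLoc_eq (f g : D.Aloc γ) :
    D.bracketLoc γ f g = D.hamiltonianLoc γ g f :=
  rfl

theorem JacobianData.bracket_self (f : RatFun (m + 2)) : D.bracket f f = 0 := by
  rw [JacobianData.bracket, jac, Matrix.det_zero_of_row_eq (i := 0) (j := 1) (by simp), mul_zero]
  ext j
  rfl

theorem JacobianData.bracket_swap (f g : RatFun (m + 2)) : D.bracket f g = -D.bracket g f := by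
  rw [JacobianData.bracket, JacobianData.bracket, jac_cons_cons, jac_cons_cons,
    Matrix.det_cons_cons_swap, mul_neg]

theorem JacobianData.bracket_div_eq_zero (i : Fin m) (g : RatFun (m + 2)) :
    D.bracket (toRat (D.s i) / toRat (D.t i)) g = 0 := by
  rw [JacobianData.bracket, jac, Matrix.det_zero_of_row_eq (i := 0) (j := i.succ.succ)
    (Fin.succ_ne_zero _).symm, mul_zero]
  ext j
  rfl

theorem JacobianData.bracket_v_eq_zero (i : Fin m) (g : RatFun (m + 2)) :
    D.bracket (D.v γ i) g = 0 := by
  rw [JacobianData.v]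
  split_ifs
  · exact D.bracket_div_eq_zero i g
  · rw [← D.hamiltonian_apply, ← inv_div, Derivation.leibniz_inv, D.hamiltonian_apply,
      D.bracket_div_eq_zero, smul_zero]

/-- The factor is `tᵢ ^ 2` or `-sᵢ ^ 2`, because `tᵢ² d(sᵢ / tᵢ) = -sᵢ² d(tᵢ / sᵢ)`. -/
theorem JacobianData.exists_mul_ratPderiv_v (i : Fin m) : ∃ c ∈ D.Aloc γ, ∀ j,
    toRat (D.t i) ^ 2 * ratPderiv j (toRat (D.s i) / toRat (D.t i)) =
      c * ratPderiv j (D.v γ i) := by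
  have hs := toRat_ne_zero (D.s_ne_zero i)
  have ht := toRat_ne_zero (D.t_ne_zero i)
  rw [JacobianData.v]
  split_ifs
  · exact ⟨toRat (D.t i) ^ 2, pow_mem (D.toRat_mem γ _) 2, fun j => rfl⟩
  · refine ⟨-toRat (D.s i) ^ 2, neg_mem (pow_mem (D.toRat_mem γ _) 2), fun j => ?_⟩
    rw [← inv_div (toRat (D.s i)), Derivation.leibniz_inv, smul_eq_mul]
    field_simp

theorem JacobianData.exists_bracket_eq_mul_jac : ∃ c ∈ D.Aloc γ, ∀ f g : RatFun (m + 2),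
    D.bracket f g = c * jac (Fin.cons f (Fin.cons g fun i => D.v γ i)) := by
  choose c hc h using D.exists_mul_ratPderiv_v γ
  have e : (fun i j => toRat (D.t i) ^ 2 * ratPderiv j (toRat (D.s i) / toRat (D.t i))) =
      fun i j => c i * ratPderiv j (D.v γ i) := funext fun i => funext fun j => h i j
  refine ⟨∏ i, c i, Subalgebra.prod_mem _ fun i _ => hc i, fun f g => ?_⟩
  rw [JacobianData.bracket, ← Finset.prod_pow, jac_cons_cons, ← Matrix.det_cons_cons_mul, e,
    Matrix.det_cons_cons_mul, jac_cons_cons]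

end PoissonSpectra

/-! ### The localization `A_γ` -/

namespace PoissonSpectra

variable {m : ℕ} (D : JacobianData m) (γ : Gam m)

instance JacobianData.isLocalization_Aloc : IsLocalization (D.M γ) (D.Aloc γ) :=
  Localization.subalgebra.isLocalization_ofField _ _ (D.M_le γ)

instance JacobianData.formallyEtale_Aloc : Algebra.FormallyEtale (Poly (m + 2)) (D.Aloc γ) :=
  .of_isLocalization (D.M γ)

instance JacobianData.formallySmooth_Aloc : Algebra.FormallySmooth ℂ (D.Aloc γ) :=
  .comp ℂ (Poly (m + 2)) (D.Aloc γ)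

theorem JacobianData.finite_S : (D.S γ).Finite := by
  refine ((Set.finite_range D.s).union (Set.finite_range D.t)).subset ?_
  rintro p ⟨i, ⟨-, rfl⟩ | ⟨-, rfl⟩⟩
  · exact Or.inl ⟨i, rfl⟩
  · exact Or.inr ⟨i, rfl⟩

instance JacobianData.finiteType_Aloc : Algebra.FiniteType ℂ (D.Aloc γ) := by
  have : Monoid.FG (D.M γ) := (Monoid.fg_iff_submonoid_fg _).2
    ((Submonoid.fg_iff _).2 ⟨D.S γ, rfl, D.finite_S γ⟩)
  have : Algebra.FiniteType (Poly (m + 2)) (D.Aloc γ) :=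
    IsLocalization.finiteType_of_monoid_fg (D.M γ) _
  exact .trans (inferInstance : Algebra.FiniteType ℂ (Poly (m + 2))) this

instance JacobianData.isNoetherianRing_Aloc : IsNoetherianRing (D.Aloc γ) :=
  Algebra.FiniteType.isNoetherianRing ℂ _

variable {γ}

/-- `vᵢ` as an element of `A_γ`. -/
noncomputable def JacobianData.vLoc (hγ : IsDense γ) (i : Fin m) : D.Aloc γ := ⟨D.v γ i, D.v_mem hγ i⟩

theorem JacobianData.hamiltonianLoc_vLoc (hγ : IsDense γ) (g : D.Aloc γ) (i : Fin m) :
    D.hamiltonianLoc γ g (D.vLoc hγ i) = 0 :=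
  Subtype.ext (D.bracket_v_eq_zero γ i g)

/-- The bijection that lists the two indices in `Fin 2` before those in `Fin m`. -/
def finTwoSumEquiv (m : ℕ) : Fin 2 ⊕ Fin m ≃ Fin (m + 2) :=
  finSumFinEquiv.trans (finCongr (Nat.add_comm 2 m))

theorem sumElim_comp_finTwoSumEquiv_symm {α : Type*} (f g : α) (v : Fin m → α) :
    Sum.elim ![f, g] v ∘ (finTwoSumEquiv m).symm = Fin.cons f (Fin.cons g v) := by
  rw [Equiv.comp_symm_eq]
  ext (i | i)
  · fin_cases i <;> rfl
  · have : finTwoSumEquiv m (Sum.inr i) = i.succ.succ := by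
      ext
      simp only [finTwoSumEquiv, Equiv.trans_apply, finSumFinEquiv_apply_right,
        finCongr_apply_coe, Fin.val_natAdd, Fin.val_succ]
      omega
    simp [this]

theorem JacobianData.det_repr_D (hγ : IsDense γ) (f g : D.Aloc γ) :
    (Matrix.of fun i j => ((basisOfFormallyEtale ℂ (Fin (m + 2)) (D.Aloc γ)).reindex
        (finTwoSumEquiv m).symm).repr
          (KaehlerDifferential.D ℂ (D.Aloc γ) (Sum.elim ![f, g] (D.vLoc hγ) i)) j).det =
      (Matrix.of fun i j => D.pderivLoc γ j
        ((Fin.cons f (Fin.cons g (D.vLoc hγ)) : Fin (m + 2) → D.Aloc γ) i)).det := by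
  rw [← Matrix.det_submatrix_equiv_self (finTwoSumEquiv m)]
  congr 1
  ext1 i j
  rw [← sumElim_comp_finTwoSumEquiv_symm, Matrix.submatrix_apply, Matrix.of_apply,
    Matrix.of_apply, Module.Basis.repr_reindex_apply, Equiv.symm_symm,
    basisOfFormallyEtale_repr _ (D.pderivLoc_algebraMap_X γ), Function.comp_apply,
    Equiv.symm_apply_apply]

theorem JacobianData.coe_det_pderivLoc (hγ : IsDense γ) (f g : D.Aloc γ) :
    (((Matrix.of fun i j => D.pderivLoc γ j
      ((Fin.cons f (Fin.cons g (D.vLoc hγ)) : Fin (m + 2) → D.Aloc γ) i)).det : D.Aloc γ) :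
        RatFun (m + 2)) =
      jac (Fin.cons (f : RatFun (m + 2)) (Fin.cons (g : RatFun (m + 2)) fun i => D.v γ i)) := by
  refine (RingHom.map_det (D.Aloc γ).val.toRingHom _).trans ?_
  rw [jac_cons_cons]
  congr 1
  ext i j
  refine Fin.cases ?_ (fun i => Fin.cases ?_ (fun i => ?_) i) i <;> rfl

/-- Up to a factor in `A_γ`, the bracket `{f, g}` is the determinant of the coordinates of the
differentials of `f, g, v₁, …, vₘ`. -/
theorem JacobianData.exists_bracketLoc_eq_mul_det (hγ : IsDense γ) : ∃ c : D.Aloc γ,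
    ∀ f g : D.Aloc γ, D.bracketLoc γ f g = c *
      (Matrix.of fun i j => ((basisOfFormallyEtale ℂ (Fin (m + 2)) (D.Aloc γ)).reindex
        (finTwoSumEquiv m).symm).repr
          (KaehlerDifferential.D ℂ (D.Aloc γ) (Sum.elim ![f, g] (D.vLoc hγ) i)) j).det := by
  obtain ⟨c, hc, h⟩ := D.exists_bracket_eq_mul_jac γ
  refine ⟨⟨c, hc⟩, fun f g => ?_⟩
  rw [D.det_repr_D]
  refine Subtype.ext ((h f g).trans ?_)
  rw [← D.coe_det_pderivLoc hγ]
  rfl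

/-- `ht Q = ht (Q ∩ C_γ)` for a prime Poisson ideal `Q` that is not residually null. -/
theorem JacobianData.height_eq_height_comap (hγ : IsDense γ) :
    ∀ Q : Ideal (D.Aloc γ), Q.IsPrime → IsPoissonIdeal (D.bracketLoc γ) Q →
      ¬ IsResiduallyNull (D.bracketLoc γ) Q →
        Q.height = (Q.comap (algebraMap (D.C hγ) (D.Aloc γ))).height := by
  intro Q hprime hQ hres
  simp only [IsResiduallyNull, not_forall, Ideal.Quotient.eq_zero_iff_mem] at hres
  obtain ⟨f, g, hfg⟩ := hres
  obtain ⟨c, hc⟩ := D.exists_bracketLoc_eq_mul_det hγ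
  exact Ideal.height_eq_height_comap_adjoin_casimirs _ (D.vLoc hγ) (D.hamiltonianLoc γ)
    (fun a => Subtype.ext (D.bracket_self a)) (fun a b => Subtype.ext (D.bracket_swap b a))
    (D.hamiltonianLoc_vLoc hγ) f g Q (fun b a ha => hQ a ha b) hfg
    fun h => hfg (hc f g ▸ Q.mul_mem_left c h)

/-- Every element of `C_γ` is a Casimir, so extended ideals are Poisson. -/
theorem JacobianData.isPoissonIdeal_map (hγ : IsDense γ) (I : Ideal (D.C hγ)) :
    IsPoissonIdeal (D.bracketLoc γ) (I.map (algebraMap (D.C hγ) (D.Aloc γ))) := by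
  intro x hx g
  have hcas (y : D.C hγ) : D.hamiltonianLoc γ g y = 0 :=
    Derivation.eqOn_adjoin (D2 := 0) (by
      rintro _ ⟨i, rfl⟩
      exact D.hamiltonianLoc_vLoc hγ g i) y.2
  change D.hamiltonianLoc γ g x ∈ _
  induction hx using Submodule.span_induction with
  | mem x hx =>
    obtain ⟨y, -, rfl⟩ := hx
    change D.hamiltonianLoc γ g (y : D.Aloc γ) ∈ _
    rw [hcas]
    exact zero_mem _
  | zero => rw [map_zero]; exact zero_mem _
  | add x y _ _ hx hy => rw [map_add]; exact add_mem hx hy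
  | smul a x hx' hx =>
    rw [smul_eq_mul, Derivation.leibniz]
    exact add_mem (Ideal.mul_mem_left _ _ hx) (Ideal.mul_mem_right _ _ hx')

end PoissonSpectra

theorem theorem2p19 {m : ℕ} (hm : 1 ≤ m) (D : PoissonSpectra.JacobianData m)
    (γ : PoissonSpectra.Gam m) (hγ : PoissonSpectra.IsDense γ) :
    (∀ (I : Ideal (D.C hγ)) (Q : Ideal (D.Aloc γ)),
      Q ∈ (I.map (algebraMap (D.C hγ) (D.Aloc γ))).minimalPrimes →
        PoissonSpectra.IsPoissonPrime (D.bracketLoc γ) Q) ∧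
    (∀ Q : Ideal (D.Aloc γ), Q ≠ ⊥ →
      PoissonSpectra.IsProperPoissonPrime (D.bracketLoc γ) Q →
        Q.height = (Q.comap (algebraMap (D.C hγ) (D.Aloc γ))).height) ∧
    (∀ Q : Ideal (D.Aloc γ), Q ≠ ⊥ →
      PoissonSpectra.IsProperPoissonPrime (D.bracketLoc γ) Q →
        Q ∈ ((Q.comap (algebraMap (D.C hγ) (D.Aloc γ))).map
          (algebraMap (D.C hγ) (D.Aloc γ))).minimalPrimes) := by
  have part1 (I : Ideal (D.C hγ)) (Q : Ideal (D.Aloc γ))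
      (hQ : Q ∈ (I.map (algebraMap (D.C hγ) (D.Aloc γ))).minimalPrimes) :
      PoissonSpectra.IsPoissonPrime (D.bracketLoc γ) Q :=
    .of_mem_minimalPrimes (D.hamiltonianLoc γ) (D.bracketLoc_eq γ) (D.isPoissonIdeal_map hγ I) hQ
  refine ⟨part1, fun Q _ hQ => ?_, fun Q _ hQ => ?_⟩
  · have := hQ.1.isPrime (D.hamiltonianLoc γ) (D.bracketLoc_eq γ)
    exact D.height_eq_height_comap hγ Q this hQ.1.1 hQ.2
  · have := hQ.1.isPrime (D.hamiltonianLoc γ) (D.bracketLoc_eq γ)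
    -- A minimal prime `P ≤ Q` over `(Q ∩ C_γ) A_γ` has the same height as `Q`, so it equals `Q`.
    obtain ⟨P, hP, hPQ⟩ := Ideal.exists_minimalPrimes_le (Ideal.map_comap_le (K := Q)
      (f := algebraMap (D.C hγ) (D.Aloc γ)))
    have hPp : P.IsPrime := hP.1.1
    have hcomap : P.comap (algebraMap (D.C hγ) (D.Aloc γ)) =
        Q.comap (algebraMap (D.C hγ) (D.Aloc γ)) :=
      le_antisymm (Ideal.comap_mono hPQ) (Ideal.map_le_iff_le_comap.1 hP.1.2)
    have hPres : ¬ PoissonSpectra.IsResiduallyNull (D.bracketLoc γ) P := fun h =>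
      hQ.2 fun a b => Ideal.Quotient.eq_zero_iff_mem.2
        (hPQ (Ideal.Quotient.eq_zero_iff_mem.1 (h a b)))
    have hle : Q.height ≤ P.height := by
      rw [D.height_eq_height_comap hγ Q this hQ.1.1 hQ.2,
        D.height_eq_height_comap hγ P hPp (part1 _ _ hP).1 hPres, hcomap]
    have hQP : Q ∈ P.minimalPrimes := Ideal.mem_minimalPrimes_of_height_le hPQ hle
    rw [Ideal.minimalPrimes_eq_subsingleton_self] at hQP
    exact hQP ▸ hP
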